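/- **Setting.** All Hilbert spaces are finite-dimensional and complex, all outcome sets are finite, and $\log=\log_2$ with $0\log 0=0$. Let $\mathcal H$ be a system of dimension $d\ge 1$. A measuring apparatus is a quantum instrument $\mathcal M=\{\mathcal M^m\}_{m\in\mathsf M}$: a family of completely positive maps from operators on $\mathcal H$ to operators on an output space $\mathcal K$ such that $\sum_m\mathcal M^m$ is trace-preserving. It also denotes the map $\mathcal M(\rho)=\sum_m\mathcal M^m(\rho)\otimes|m\rangle\langle m|$ into operators on $\mathcal K\otimes\mathbb C^{\mathsf M}$. For a joint distribution $p(a,b)$ on a product of two finite sets, $H(A|B)=-\sum_{a,b}p(a,b)\log p(a|b)$ with $p(a|b)=p(a,b)/\sum_{a'}p(a',b)$. Let $X$ and $Z$ be self-adjoint operators on $\mathcal H$, possibly degenerate. Let $X_x$ be the orthogonal projectors onto the eigenspaces of $X$, indexed by its distinct eigenvalues, with $d_x=\operatorname{rank}X_x$, and let $Z_z$ and $d'_z=\operatorname{rank}Z_z$ be the corresponding objects for $Z$. **Noise.** The state $X_x/d_x$ is input with prior probability $d_x/d$, which gives the joint distribution $p(m,x)=\frac{d_x}{d}\operatorname{Tr}[\mathcal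 M^m(X_x/d_x)]$. The noise is $\mathsf N(\mathcal M,X):=H(X|M)$ for this distribution. **Disturbance.** The state $Z_z/d'_z$ is input with prior probability $d'_z/d$. For a completely positive trace-preserving map $\mathcal E$ from operators on $\mathcal K\otimes\mathbb C^{\mathsf M}$ to operators on $\mathcal H$, let $p(\hat z,z)=\frac{d'_z}{d}\operatorname{Tr}\big[Z_{\hat z}\,(\mathcal E\circ\mathcal M)(Z_z/d'_z)\big]$, where $\hat z$ also ranges over the distinct eigenvalues of $Z$. The disturbance is $\mathsf D(\mathcal M,Z):=\min_{\mathcal E}H(Z|\hat Z)$, the minimum being over all such $\mathcal E$. **Statement.** For every such $\mathcal H$, $\mathcal M$, $X$ and $Z$, the minimum defining $\mathsf D(\mathcal M,Z)$ is attained, and $$\mathsf N(\mathcal M,X)+\mathsf D(\mathcal M,Z)\ \ge\ -\log c',\qquad c'=\max_{x,z}\|X_xZ_z\|_\infty^2,$$ where the maximum is over all pairs of an eigenvalue of $X$ and an eigenvalue of $Z$, and $\|\cdot\|_\infty$ is the operator norm (the largest singular value). -/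

import Mathlib

open scoped TensorProduct CStarAlgebra

namespace NoiseDisturbance

/-- Every finite-dimensional complex inner product space is complete. -/
instance completeSpace_of_finiteDimensional {E : Type*} [NormedAddCommGroup E]
    [InnerProductSpace ℂ E] [FiniteDimensional ℂ E] : CompleteSpace E :=
  FiniteDimensional.complete ℂ E

noncomputable section

/-! ### Channels and instruments -/

/-- The algebra of linear operators on the finite-dimensional Hilbert space `H`
(a C⋆-algebra with its operator norm and the Loewner order). -/
abbrev Op (H : Type*) [NormedAddCommGroup H] [InnerProductSpace ℂ H] : Type _ := H →L[ℂ] H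

/-- The trace of an operator. -/
def tr {H : Type*} [NormedAddCommGroup H] [InnerProductSpace ℂ H] (A : Op H) : ℂ :=
  LinearMap.trace ℂ H (A : H →ₗ[ℂ] H)

/-- A quantum channel: a completely positive trace-preserving map from operators on `H`
to operators on `K`. -/
structure Channel (H K : Type*)
    [NormedAddCommGroup H] [InnerProductSpace ℂ H] [FiniteDimensional ℂ H]
    [NormedAddCommGroup K] [InnerProductSpace ℂ K] [FiniteDimensional ℂ K] where
  /-- The underlying completely positive map. -/
  map : Op H →CP Op K
  trace_preserving : ∀ ρ : Op H, tr (map ρ) = tr ρ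

/-- A quantum instrument with input space `H`, output space `K` and finite outcome set `M`:
a family of completely positive maps indexed by the outcomes whose sum is trace-preserving. -/
structure Instrument (H K M : Type*)
    [NormedAddCommGroup H] [InnerProductSpace ℂ H] [FiniteDimensional ℂ H]
    [NormedAddCommGroup K] [InnerProductSpace ℂ K] [FiniteDimensional ℂ K]
    [Fintype M] where
  /-- The completely positive map belonging to an outcome. -/
  map : M → (Op H →CP Op K)
  trace_preserving : ∀ ρ : Op H, tr (∑ m, map m ρ) = tr ρ

/-- The flag state `|m⟩⟨m|` on the classical register `ℂ^M`. -/
def flag {M : Type*} [Fintype M] [DecidableEq M] (m : M) : Op (EuclideanSpace ℂ M) :=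
  InnerProductSpace.rankOne ℂ (EuclideanSpace.single m (1 : ℂ)) (EuclideanSpace.single m (1 : ℂ))

/-- The output `∑ m, 𝓜ᵐ(ρ) ⊗ |m⟩⟨m|` of the apparatus on the joint system formed by the output
quantum system and the classical register. -/
def Instrument.apply {H K M : Type*}
    [NormedAddCommGroup H] [InnerProductSpace ℂ H] [FiniteDimensional ℂ H]
    [NormedAddCommGroup K] [InnerProductSpace ℂ K] [FiniteDimensional ℂ K]
    [Fintype M] [DecidableEq M] (𝓜 : Instrument H K M) (ρ : Op H) :
    Op (K ⊗[ℂ] EuclideanSpace ℂ M) :=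
  ∑ m, TensorProduct.mapL (𝓜.map m ρ) (flag m)

/-! ### Observables -/

section Observables

variable {H : Type*} [NormedAddCommGroup H] [InnerProductSpace ℂ H] [FiniteDimensional ℂ H]

/-- The index set of the distinct eigenvalues of an operator. -/
abbrev Eig (X : Op H) : Type := Module.End.Eigenvalues (X : H →ₗ[ℂ] H)

/-- The eigenspace of `X` for the eigenvalue `x`. -/
def eigenspace (X : Op H) (x : Eig X) : Submodule ℂ H :=
  Module.End.eigenspace (X : H →ₗ[ℂ] H) (x : ℂ)

/-- The spectral projector of `X` for the eigenvalue `x`: the orthogonal projector onto the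
corresponding eigenspace. -/
def spectralProj (X : Op H) (x : Eig X) : Op H := (eigenspace X x).starProjection

/-- The degeneracy of the eigenvalue `x`. -/
def degeneracy (X : Op H) (x : Eig X) : ℕ := Module.finrank ℂ (eigenspace X x)

/-- The prior probability `d_x / d` of the eigenvalue `x`. -/
def prior (X : Op H) (x : Eig X) : ℝ := (degeneracy X x : ℝ) / (Module.finrank ℂ H : ℝ)

/-- The input state `X_x / d_x`. -/
def eigenState (X : Op H) (x : Eig X) : Op H :=
  ((degeneracy X x : ℂ)⁻¹) • spectralProj X x

/-- The constant `max_{x,z} ‖X_x Z_z‖²` (operator norm). -/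
def overlap (X Z : Op H) : ℝ :=
  ⨆ p : Eig X × Eig Z, ‖spectralProj X p.1 * spectralProj Z p.2‖ ^ 2

end Observables

/-! ### Entropies, noise and disturbance -/

/-- The conditional Shannon entropy `H(A|B) = -∑ p(a,b) log₂ p(a|b)` of a joint distribution `p`
on a product of two finite sets, where `p(a|b) = p(a,b) / ∑ a', p(a',b)`. -/
def condEntropy {A B : Type*} [Fintype A] [Fintype B] (p : A → B → ℝ) : ℝ :=
  -∑ b, ∑ a, p a b * Real.logb 2 (p a b / ∑ a', p a' b)

section Measures

variable {H K M : Type*}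
  [NormedAddCommGroup H] [InnerProductSpace ℂ H] [FiniteDimensional ℂ H]
  [NormedAddCommGroup K] [InnerProductSpace ℂ K] [FiniteDimensional ℂ K]
  [Fintype M]

/-- The joint distribution `p(m,x) = (d_x / d) Tr[𝓜ᵐ(X_x / d_x)]` of the input eigenvalue and the
measurement outcome. -/
def noiseDist (𝓜 : Instrument H K M) (X : Op H) (x : Eig X) (m : M) : ℝ :=
  prior X x * (tr (𝓜.map m (eigenState X x))).re

/-- The noise `N(𝓜, X) = H(X|M)`. -/
def noise (𝓜 : Instrument H K M) (X : Op H) : ℝ := condEntropy (noiseDist 𝓜 X)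

/-- The joint distribution `p(ẑ,z) = (d_z / d) Tr[Z_ẑ (𝓔 ∘ 𝓜)(Z_z / d_z)]` of the input eigenvalue
`z` and the result `z'` of the measurement of `Z` after the correction `𝓔`. -/
def disturbanceDist [DecidableEq M] (𝓜 : Instrument H K M) (Z : Op H)
    (𝓔 : Channel (K ⊗[ℂ] EuclideanSpace ℂ M) H) (z z' : Eig Z) : ℝ :=
  prior Z z * (tr (spectralProj Z z' * 𝓔.map (𝓜.apply (eigenState Z z)))).re

/-- The entropy `H(Z|Ẑ)` remaining after the correction `𝓔`. -/
def correctedEntropy [DecidableEq M] (𝓜 : Instrument H K M) (Z : Op H)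
    (𝓔 : Channel (K ⊗[ℂ] EuclideanSpace ℂ M) H) : ℝ :=
  condEntropy (disturbanceDist 𝓜 Z 𝓔)

/-- The disturbance `D(𝓜, Z)`: the minimum of `H(Z|Ẑ)` over all correction channels. -/
def disturbance [DecidableEq M] (𝓜 : Instrument H K M) (Z : Op H) : ℝ :=
  sInf (Set.range (correctedEntropy 𝓜 Z))

end Measures

end

end NoiseDisturbance

/-!
The apparatus followed by a correction `𝓔` and a measurement of `Z` is a single joint measurement
on `H` with outcomes `(m, ẑ)`: with the maximally mixed prior it is described by the positive
functionals `L_{m,ẑ}(ρ) = (1/d) Tr[Z_ẑ 𝓔(𝓜ᵐ(ρ) ⊗ |m⟩⟨m|)]` (`jointFunctional`), where the register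
holding `m` keeps the outcome available to the correction. The distribution of the noise is the
marginal of `L_{m,ẑ}(X_x)` over `ẑ`, and that of the disturbance is the marginal of `L_{m,ẑ}(Z_z)`
over `m` (`noiseDist_eq`, `disturbanceDist_eq`). Discarding part of the conditioning data only
increases a conditional entropy (`condEntropy_le_condEntropy_sum`, the log-sum inequality), so it
suffices to bound `H(X|M Ẑ) + H(Z|M Ẑ)`, and this splits into one inequality for each `L_{m,ẑ}`.

That inequality is the Maassen–Uffink relation for the two projective measurements in the
unnormalized state `L` (`entropic_uncertainty`). In the GNS space of `L` the classes of the
projectors form two orthogonal families `φ_x`, `χ_z` with the same sum `ψ`, and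
`|⟪φ_x, χ_z⟫| ≤ ‖X_x Z_z‖ ‖φ_x‖ ‖χ_z‖`. For such families (`sum_norm_sq_mul_log_le`) the entire
function `F(ζ) = ∑ ‖φ_x‖^ζ ‖χ_z‖^ζ ⟪φ_x, χ_z⟫` is bounded by `‖ψ‖²` on `Re ζ = 0`, because there the
coefficients are phases, and by `√c' ‖ψ‖⁴` on `Re ζ = 1`. Hadamard's three-line theorem bounds `F`
on `[0, 1]` by a function with the same value at `0`; comparing the derivatives at `0` gives the
entropies.

The minimum over corrections is attained because the channels form a compact set
(`isCompact_channelSet`), nonempty since one may discard the input and prepare the maximally mixed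
state, and because conditional entropy is continuous on nonnegative distributions
(`condEntropy_eq_sum_negMulLog`).
-/

namespace NoiseDisturbance

open scoped InnerProductSpace ComplexOrder
open Complex.HadamardThreeLines

/-! ### Interpolation between two orthogonal decompositions of a vector -/

section Interpolation

variable {E : Type*} [SeminormedAddCommGroup E] [InnerProductSpace ℂ E]

lemma norm_sq_sum_smul_of_pairwise_inner_eq_zero {ι : Type*} [Fintype ι] {φ : ι → E}
    (hφ : Pairwise fun i j => ⟪φ i, φ j⟫_ℂ = 0) (u : ι → ℂ) :
    ‖∑ i, u i • φ i‖ ^ 2 = ∑ i, ‖u i‖ ^ 2 * ‖φ i‖ ^ 2 := by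
  have h : (⟪∑ i, u i • φ i, ∑ i, u i • φ i⟫_ℂ) = ∑ i, ((‖u i‖ ^ 2 * ‖φ i‖ ^ 2 : ℝ) : ℂ) := by
    rw [sum_inner]
    refine Finset.sum_congr rfl fun i _ => ?_
    rw [inner_sum, Finset.sum_eq_single i]
    · rw [inner_smul_left, inner_smul_right, inner_self_eq_norm_sq_to_K, ← mul_assoc,
        RCLike.conj_mul]
      push_cast; rfl
    · intro j _ hj
      rw [inner_smul_left, inner_smul_right, hφ hj.symm]; simp
    · simp
  rw [inner_self_eq_norm_sq_to_K] at h
  exact Complex.ofReal_injective (by push_cast; push_cast at h; exact h)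

lemma norm_sq_sum_of_pairwise_inner_eq_zero {ι : Type*} [Fintype ι] {φ : ι → E}
    (hφ : Pairwise fun i j => ⟪φ i, φ j⟫_ℂ = 0) :
    ‖∑ i, φ i‖ ^ 2 = ∑ i, ‖φ i‖ ^ 2 := by
  simpa using norm_sq_sum_smul_of_pairwise_inner_eq_zero hφ 1

/-- A nonnegative differentiable error term vanishing at the left endpoint has nonnegative
derivative there. -/
lemma deriv_nonneg_of_nonneg_right {g : ℝ → ℝ} {g' : ℝ} (hg : HasDerivAt g g' 0) (h0 : g 0 = 0)
    (hpos : ∀ t ∈ Set.Icc (0 : ℝ) 1, 0 ≤ g t) : 0 ≤ g' := by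
  have h1 := hg.hasDerivWithinAt (s := Set.Ioi 0)
  rw [hasDerivWithinAt_iff_tendsto_slope' (by simp)] at h1
  refine ge_of_tendsto h1 ?_
  filter_upwards [Ioo_mem_nhdsGT (zero_lt_one' ℝ)] with t ht
  rw [slope_def_field, h0, sub_zero, sub_zero]
  exact div_nonneg (hpos t ⟨ht.1.le, ht.2.le⟩) ht.1.le

/-- If two orthogonal families have the same sum `ψ` and their mutual inner products are at most
`k` times the products of the norms, then the weights `‖φ i‖²` and `‖χ j‖²` cannot both be
concentrated. This is the Maassen–Uffink relation in terms of vectors; the proof interpolates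
between the trivial bound on `Re ζ = 0` and the bound by `k` on `Re ζ = 1`. -/
theorem sum_norm_sq_mul_log_le {ι κ : Type*} [Fintype ι] [Fintype κ]
    {φ : ι → E} {χ : κ → E} {ψ : E} {k : ℝ}
    (hφ : Pairwise fun i j => ⟪φ i, φ j⟫_ℂ = 0) (hχ : Pairwise fun i j => ⟪χ i, χ j⟫_ℂ = 0)
    (hφψ : ∑ i, φ i = ψ) (hχψ : ∑ j, χ j = ψ) (hk : 0 < k)
    (h : ∀ i j, ‖⟪φ i, χ j⟫_ℂ‖ ≤ k * (‖φ i‖ * ‖χ j‖)) :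
    ∑ i, ‖φ i‖ ^ 2 * Real.log ‖φ i‖ + ∑ j, ‖χ j‖ ^ 2 * Real.log ‖χ j‖ ≤
      ‖ψ‖ ^ 2 * Real.log (k * ‖ψ‖ ^ 2) := by
  have hφn : ∑ i, ‖φ i‖ ^ 2 = ‖ψ‖ ^ 2 := by
    rw [← hφψ, norm_sq_sum_of_pairwise_inner_eq_zero hφ]
  have hχn : ∑ i, ‖χ i‖ ^ 2 = ‖ψ‖ ^ 2 := by
    rw [← hχψ, norm_sq_sum_of_pairwise_inner_eq_zero hχ]
  rcases eq_or_ne ‖ψ‖ 0 with hψ | hψ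
  · have h1 : ∀ i, ‖φ i‖ ^ 2 = 0 := by
      rw [hψ, zero_pow two_ne_zero,
        Finset.sum_eq_zero_iff_of_nonneg (fun _ _ => sq_nonneg _)] at hφn
      simpa using hφn
    have h2 : ∀ i, ‖χ i‖ ^ 2 = 0 := by
      rw [hψ, zero_pow two_ne_zero,
        Finset.sum_eq_zero_iff_of_nonneg (fun _ _ => sq_nonneg _)] at hχn
      simpa using hχn
    simp [h1, h2, hψ]
  have hψ0 : 0 < ‖ψ‖ := lt_of_le_of_ne (norm_nonneg _) hψ.symm
  -- `exp (ζ * log ‖φ i‖)` stands for `‖φ i‖ ^ ζ`; it is entire also when `φ i = 0`, where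
  -- `Real.log 0 = 0` makes it `1` and the inner product kills the term.
  set l : ι → κ → ℝ := fun i j => Real.log ‖φ i‖ + Real.log ‖χ j‖ with hl
  set F : ℂ → ℂ := fun ζ => ∑ i, ∑ j, Complex.exp (ζ * l i j) * ⟪φ i, χ j⟫_ℂ with hF
  have hFd : Differentiable ℂ F := by
    simp only [hF]; fun_prop
  have hFle : ∀ ζ, ‖F ζ‖ ≤ ∑ i, ∑ j, Real.exp (ζ.re * l i j) * ‖⟪φ i, χ j⟫_ℂ‖ := by
    intro ζ
    refine (norm_sum_le _ _).trans (Finset.sum_le_sum fun i _ => (norm_sum_le _ _).trans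
      (Finset.sum_le_sum fun j _ => ?_))
    rw [norm_mul, Complex.norm_exp]
    simp
  have hbdd : BddAbove ((norm ∘ F) '' verticalClosedStrip 0 1) := by
    refine ⟨∑ i, ∑ j, Real.exp |l i j| * ‖⟪φ i, χ j⟫_ℂ‖, ?_⟩
    rintro _ ⟨ζ, hζ, rfl⟩
    refine (hFle ζ).trans (Finset.sum_le_sum fun i _ => Finset.sum_le_sum fun j _ => ?_)
    gcongr
    obtain ⟨h0, h1⟩ : 0 ≤ ζ.re ∧ ζ.re ≤ 1 := hζ
    calc ζ.re * l i j ≤ ζ.re * |l i j| := by gcongr; exact le_abs_self _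
      _ ≤ 1 * |l i j| := by gcongr
      _ = _ := one_mul _
  -- On `Re ζ = 0` the coefficients are phases and preserve the norms of both orthogonal sums.
  have hleft : ∀ ζ ∈ Complex.re ⁻¹' {0}, ‖F ζ‖ ≤ ‖ψ‖ ^ 2 := by
    intro ζ hζ
    have hζ : ζ.re = 0 := hζ
    have hunit : ∀ t : ℝ, ‖Complex.exp (ζ * t)‖ = 1 := by
      intro t; rw [Complex.norm_exp]; simp [hζ]
    have hFi : F ζ = ⟪∑ i, (starRingEnd ℂ) (Complex.exp (ζ * Real.log ‖φ i‖)) • φ i,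
        ∑ j, Complex.exp (ζ * Real.log ‖χ j‖) • χ j⟫_ℂ := by
      rw [sum_inner]
      refine Finset.sum_congr rfl fun i _ => ?_
      rw [inner_sum]
      refine Finset.sum_congr rfl fun j _ => ?_
      rw [inner_smul_left, inner_smul_right, Complex.conj_conj, ← mul_assoc, ← Complex.exp_add]
      simp only [hl]; push_cast; ring_nf
    have hnφ : ‖∑ i, (starRingEnd ℂ) (Complex.exp (ζ * Real.log ‖φ i‖)) • φ i‖ = ‖ψ‖ := by
      rw [← sq_eq_sq₀ (norm_nonneg _) (norm_nonneg _),
        norm_sq_sum_smul_of_pairwise_inner_eq_zero hφ, ← hφn]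
      simp only [RCLike.norm_conj, hunit, one_pow, one_mul]
    have hnχ : ‖∑ j, Complex.exp (ζ * Real.log ‖χ j‖) • χ j‖ = ‖ψ‖ := by
      rw [← sq_eq_sq₀ (norm_nonneg _) (norm_nonneg _),
        norm_sq_sum_smul_of_pairwise_inner_eq_zero hχ, ← hχn]
      simp only [hunit, one_pow, one_mul]
    rw [hFi]
    refine (norm_inner_le_norm _ _).trans ?_
    rw [hnφ, hnχ, sq]
  -- On `Re ζ = 1` the coefficients are `‖φ i‖ * ‖χ j‖`, and the hypothesis squares each factor.
  have hright : ∀ ζ ∈ Complex.re ⁻¹' {1}, ‖F ζ‖ ≤ ‖ψ‖ ^ 2 * (k * ‖ψ‖ ^ 2) := by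
    intro ζ hζ
    have hζ : ζ.re = 1 := hζ
    calc ‖F ζ‖ ≤ ∑ i, ∑ j, Real.exp (ζ.re * l i j) * ‖⟪φ i, χ j⟫_ℂ‖ := hFle ζ
      _ ≤ ∑ i, ∑ j, k * (‖φ i‖ ^ 2 * ‖χ j‖ ^ 2) := by
          refine Finset.sum_le_sum fun i _ => Finset.sum_le_sum fun j _ => ?_
          have hij := h i j
          rcases (norm_nonneg (φ i)).eq_or_lt with hi | hi
          · rw [← hi] at hij ⊢
            have : ‖⟪φ i, χ j⟫_ℂ‖ = 0 := le_antisymm (by simpa using hij) (norm_nonneg _)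
            simp [this]
          rcases (norm_nonneg (χ j)).eq_or_lt with hj | hj
          · rw [← hj] at hij ⊢
            have : ‖⟪φ i, χ j⟫_ℂ‖ = 0 := le_antisymm (by simpa using hij) (norm_nonneg _)
            simp [this]
          have hexp : Real.exp (ζ.re * l i j) = ‖φ i‖ * ‖χ j‖ := by
            rw [hζ, one_mul, Real.exp_add, Real.exp_log hi, Real.exp_log hj]
          rw [hexp]
          calc ‖φ i‖ * ‖χ j‖ * ‖⟪φ i, χ j⟫_ℂ‖
              ≤ ‖φ i‖ * ‖χ j‖ * (k * (‖φ i‖ * ‖χ j‖)) := by gcongr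
            _ = _ := by ring
      _ = k * ((∑ i, ‖φ i‖ ^ 2) * ∑ j, ‖χ j‖ ^ 2) := by
          simp only [← Finset.mul_sum, ← Finset.sum_mul]
      _ = _ := by rw [hφn, hχn]; ring
  have hstrip : ∀ t ∈ Set.Icc (0 : ℝ) 1, ‖F t‖ ≤ ‖ψ‖ ^ 2 * (k * ‖ψ‖ ^ 2) ^ t := by
    intro t ht
    have := norm_le_interp_of_mem_verticalClosedStrip' (z := (t : ℂ)) zero_lt_one
      (by simpa [verticalClosedStrip] using ht) hFd.diffContOnCl hbdd hleft hright
    refine this.trans_eq ?_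
    simp only [Complex.ofReal_re, sub_zero, div_one]
    rw [Real.mul_rpow (by positivity) (by positivity), ← mul_assoc, ← Real.rpow_add (by positivity)]
    simp
  have hre : ∀ t : ℝ, (F t).re = ∑ i, ∑ j, Real.exp (t * l i j) * (⟪φ i, χ j⟫_ℂ).re := by
    intro t
    simp only [hF, Complex.re_sum]
    refine Finset.sum_congr rfl fun i _ => Finset.sum_congr rfl fun j _ => ?_
    rw [← Complex.ofReal_mul, ← Complex.ofReal_exp, Complex.re_ofReal_mul]
  have hφψ' : ∀ i, ∑ j, (⟪φ i, χ j⟫_ℂ).re = ‖φ i‖ ^ 2 := by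
    intro i
    rw [← Complex.re_sum, ← inner_sum, hχψ, ← hφψ, inner_sum, Finset.sum_eq_single i]
    · rw [inner_self_eq_norm_sq_to_K]; norm_cast
    · exact fun j _ hj => hφ hj.symm
    · simp
  have hχψ' : ∀ j, ∑ i, (⟪φ i, χ j⟫_ℂ).re = ‖χ j‖ ^ 2 := by
    intro j
    rw [← Complex.re_sum, ← sum_inner, hφψ, ← hχψ, sum_inner, Finset.sum_eq_single j]
    · rw [inner_self_eq_norm_sq_to_K]; norm_cast
    · exact fun i _ hi => hχ hi
    · simp
  have hkψ : 0 < k * ‖ψ‖ ^ 2 := by positivity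
  -- The bound on `[0, 1]` is an equality at `0`, so the derivatives there are ordered.
  have hder : HasDerivAt (fun t : ℝ => ‖ψ‖ ^ 2 * (k * ‖ψ‖ ^ 2) ^ t -
      ∑ i, ∑ j, Real.exp (t * l i j) * (⟪φ i, χ j⟫_ℂ).re)
      (‖ψ‖ ^ 2 * Real.log (k * ‖ψ‖ ^ 2) - ∑ i, ∑ j, l i j * (⟪φ i, χ j⟫_ℂ).re) 0 := by
    refine HasDerivAt.sub ?_ ?_
    · have := (Real.hasStrictDerivAt_const_rpow hkψ 0).hasDerivAt.const_mul (‖ψ‖ ^ 2)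
      simpa using this
    · refine HasDerivAt.fun_sum fun i _ => HasDerivAt.fun_sum fun j _ => ?_
      have := (((hasDerivAt_id (0 : ℝ)).mul_const (l i j)).exp).mul_const (⟪φ i, χ j⟫_ℂ).re
      simpa using this
  have hnonneg := deriv_nonneg_of_nonneg_right hder
    (by simp [hφψ', hφn]) (fun t ht => by
      rw [← hre]
      exact sub_nonneg.2 ((Complex.re_le_norm _).trans (hstrip t ht)))
  have hsum : ∑ i, ∑ j, l i j * (⟪φ i, χ j⟫_ℂ).re =
      ∑ i, ‖φ i‖ ^ 2 * Real.log ‖φ i‖ + ∑ j, ‖χ j‖ ^ 2 * Real.log ‖χ j‖ := by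
    simp only [hl, add_mul, Finset.sum_add_distrib]
    congr 1
    · refine Finset.sum_congr rfl fun i _ => ?_
      rw [← Finset.mul_sum, hφψ', mul_comm]
    · rw [Finset.sum_comm]
      refine Finset.sum_congr rfl fun j _ => ?_
      rw [← Finset.mul_sum, hχψ', mul_comm]
  rw [← hsum]
  exact sub_nonneg.1 hnonneg

end Interpolation

/-! ### Conditional entropy -/

section Entropy

variable {A B C : Type*} [Fintype A] [Fintype B] [Fintype C]

/-- Conditioning on less data increases the entropy: `H(A|BC) ≤ H(A|B)` for a nonnegative `p`. -/
theorem condEntropy_le_condEntropy_sum {p : A → B → C → ℝ} (hp : ∀ a b c, 0 ≤ p a b c) :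
    condEntropy (fun a (bc : B × C) => p a bc.1 bc.2) ≤ condEntropy fun a b => ∑ c, p a b c := by
  rw [condEntropy, condEntropy, neg_le_neg_iff, Fintype.sum_prod_type]
  refine Finset.sum_le_sum fun b _ => ?_
  refine le_trans (Finset.sum_le_sum fun a _ => ?_) Finset.sum_comm.le
  rw [Finset.sum_comm (s := Finset.univ (α := A)), Finset.sum_mul, ← sub_nonneg,
    ← Finset.sum_sub_distrib]
  set W : C → ℝ := fun c => ∑ a', p a' b c
  have hW : ∀ c, 0 ≤ W c := fun c => Finset.sum_nonneg fun _ _ => hp _ _ _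
  set P : ℝ := ∑ c, p a b c
  have hP : 0 ≤ P := Finset.sum_nonneg fun _ _ => hp _ _ _
  have hlog2 : (0 : ℝ) < Real.log 2 := Real.log_pos one_lt_two
  have hWP : P ≤ ∑ c, W c :=
    Finset.sum_le_sum fun c _ => Finset.single_le_sum (f := fun a' : A => p a' b c)
      (fun _ _ => hp _ _ _) (Finset.mem_univ a)
  -- each term is bounded below by the inequality `1 - t⁻¹ ≤ log t`
  have key : ∀ c, (p a b c - P / (∑ c, W c) * W c) / Real.log 2 ≤
      p a b c * Real.logb 2 (p a b c / W c) - p a b c * Real.logb 2 (P / ∑ c, W c) := by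
    intro c
    rcases (hp a b c).eq_or_lt with h0 | h0
    · rw [← h0]
      have : 0 ≤ P / (∑ c, W c) * W c := by
        have := Finset.sum_nonneg fun c (_ : c ∈ Finset.univ) => hW c
        have := hW c
        positivity
      simp only [zero_mul, sub_zero, zero_sub]
      exact div_nonpos_of_nonpos_of_nonneg (neg_nonpos.2 this) hlog2.le
    · have hWc : 0 < W c := h0.trans_le (Finset.single_le_sum (f := fun a' => p a' b c)
        (fun _ _ => hp _ _ _) (Finset.mem_univ a))
      have hPc : 0 < P := h0.trans_le (Finset.single_le_sum (f := fun c => p a b c)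
        (fun _ _ => hp _ _ _) (Finset.mem_univ c))
      have hS : 0 < ∑ c, W c := hPc.trans_le hWP
      rw [Real.logb, Real.logb, ← mul_sub, ← sub_div, ← mul_div_assoc,
        div_le_div_iff_of_pos_right hlog2, ← Real.log_div (by positivity) (by positivity)]
      have h1 := Real.one_sub_inv_le_log_of_pos
        (x := p a b c / W c / (P / ∑ c, W c)) (by positivity)
      refine le_trans (le_of_eq ?_) (mul_le_mul_of_nonneg_left h1 h0.le)
      field_simp
  refine le_trans (le_of_eq ?_) (Finset.sum_le_sum fun c _ => key c)
  rw [← Finset.sum_div, Finset.sum_sub_distrib, ← Finset.mul_sum]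
  -- the lower bounds sum to zero, also when `∑ W = 0` and the quotient `P / ∑ W` is junk
  rcases (Finset.sum_nonneg fun c (_ : c ∈ Finset.univ) => hW c).eq_or_lt with hS | hS
  · have : P = 0 := le_antisymm (hWP.trans_eq hS.symm) hP
    change 0 = (P - _) / _
    rw [this]; simp
  · change 0 = (P - _) / _
    rw [div_mul_cancel₀ _ hS.ne', sub_self, zero_div]

/-- The chain rule `H(A|B) = H(AB) - H(B)`, which exhibits the conditional entropy as a continuous
function of a nonnegative distribution. -/
lemma condEntropy_eq_sum_negMulLog {p : A → B → ℝ} (hp : ∀ a b, 0 ≤ p a b) :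
    condEntropy p = (∑ b, ∑ a, Real.negMulLog (p a b) - ∑ b, Real.negMulLog (∑ a, p a b)) /
      Real.log 2 := by
  rw [condEntropy, ← Finset.sum_sub_distrib, Finset.sum_div, ← Finset.sum_neg_distrib]
  refine Finset.sum_congr rfl fun b _ => ?_
  have : Real.negMulLog (∑ a, p a b) = ∑ a, -(p a b * Real.log (∑ a, p a b)) := by
    rw [Real.negMulLog, Finset.sum_neg_distrib, ← Finset.sum_mul, neg_mul]
  rw [this, ← Finset.sum_sub_distrib, Finset.sum_div, ← Finset.sum_neg_distrib]
  refine Finset.sum_congr rfl fun a _ => ?_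
  rcases (hp a b).eq_or_lt with h0 | h0
  · simp [← h0]
  · have hS : 0 < ∑ a, p a b := h0.trans_le (Finset.single_le_sum (f := fun a' => p a' b)
        (fun _ _ => hp _ _) (Finset.mem_univ a))
    rw [Real.logb, Real.log_div h0.ne' hS.ne', Real.negMulLog]
    ring

end Entropy

/-! ### The entropic uncertainty relation in a positive functional -/

section PositiveFunctional

variable {A : Type*} [CStarAlgebra A] [PartialOrder A] [StarOrderedRing A] (f : A →ₚ[ℂ] ℂ)

lemma norm_toPreGNS_sq_of_isStarProjection {P : A} (hP : IsStarProjection P) :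
    ‖f.toPreGNS P‖ ^ 2 = (f P).re := by
  have h := f.preGNS_norm_sq (f.toPreGNS P)
  rw [PositiveLinearMap.ofPreGNS_toPreGNS, hP.isSelfAdjoint.star_eq, hP.isIdempotentElem.eq] at h
  rw [← h, ← Complex.ofReal_pow, Complex.ofReal_re]

/-- Writing `P Q = P (P Q) Q` splits the correlation of two projections into the weights of `P`
and `Q` and the operator norm of `P Q`. -/
lemma norm_inner_toPreGNS_le {P Q : A} (hP : IsStarProjection P) (hQ : IsStarProjection Q) :
    ‖⟪f.toPreGNS P, f.toPreGNS Q⟫_ℂ‖ ≤ ‖P * Q‖ * (‖f.toPreGNS P‖ * ‖f.toPreGNS Q‖) := by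
  have h1 : ⟪f.toPreGNS P, f.toPreGNS Q⟫_ℂ =
      ⟪f.toPreGNS P, f.leftMulMapPreGNS (P * Q) (f.toPreGNS Q)⟫_ℂ := by
    rw [PositiveLinearMap.preGNS_inner_def, PositiveLinearMap.preGNS_inner_def]
    simp only [PositiveLinearMap.ofPreGNS_toPreGNS, PositiveLinearMap.leftMulMapPreGNS_apply,
      hP.isSelfAdjoint.star_eq]
    rw [mul_assoc P Q Q, hQ.isIdempotentElem.eq, ← mul_assoc, hP.isIdempotentElem.eq]
  have h2 : ‖f.leftMulMapPreGNS (P * Q) (f.toPreGNS Q)‖ ≤ ‖P * Q‖ * ‖f.toPreGNS Q‖ :=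
    ContinuousLinearMap.le_of_opNorm_le _
      (LinearMap.mkContinuous_norm_le _ (norm_nonneg _) _) _
  rw [h1]
  refine (norm_inner_le_norm _ _).trans ?_
  calc _ ≤ ‖f.toPreGNS P‖ * (‖P * Q‖ * ‖f.toPreGNS Q‖) := by gcongr
    _ = _ := by ring

lemma mul_logb_div_eq {p W : ℝ} (h : W = 0 → p = 0) :
    p * Real.logb 2 (p / W) = (p * Real.log p - p * Real.log W) / Real.log 2 := by
  rcases eq_or_ne p 0 with hp | hp
  · simp [hp]
  · rw [Real.logb, Real.log_div hp fun hW => hp (h hW)]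
    ring

/-- The entropic uncertainty relation of Maassen and Uffink for two projective measurements in a
positive functional, which need not be normalized. -/
theorem entropic_uncertainty {ι κ : Type*} [Fintype ι] [Fintype κ] {P : ι → A} {Q : κ → A}
    (hP : ∀ i, IsStarProjection (P i)) (hQ : ∀ j, IsStarProjection (Q j))
    (hP0 : Pairwise fun i j => P i * P j = 0) (hQ0 : Pairwise fun i j => Q i * Q j = 0)
    (hP1 : ∑ i, P i = 1) (hQ1 : ∑ j, Q j = 1) {c : ℝ} (hc : 0 < c)
    (h : ∀ i j, ‖P i * Q j‖ ^ 2 ≤ c) :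
    ∑ i, (f (P i)).re * Real.logb 2 ((f (P i)).re / (f 1).re) +
      ∑ j, (f (Q j)).re * Real.logb 2 ((f (Q j)).re / (f 1).re) ≤ (f 1).re * Real.logb 2 c := by
  have hlog2 : (0 : ℝ) < Real.log 2 := Real.log_pos one_lt_two
  have hsumP : ∑ i, (f (P i)).re = (f 1).re := by rw [← Complex.re_sum, ← map_sum, hP1]
  have hsumQ : ∑ j, (f (Q j)).re = (f 1).re := by rw [← Complex.re_sum, ← map_sum, hQ1]
  have hP' : ∀ i, 0 ≤ (f (P i)).re := fun i => by
    rw [← norm_toPreGNS_sq_of_isStarProjection f (hP i)]; positivity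
  have hQ' : ∀ i, 0 ≤ (f (Q i)).re := fun i => by
    rw [← norm_toPreGNS_sq_of_isStarProjection f (hQ i)]; positivity
  have hPz : (f 1).re = 0 → ∀ i, (f (P i)).re = 0 := fun h0 i => by
    rw [← hsumP, Finset.sum_eq_zero_iff_of_nonneg fun i _ => hP' i] at h0
    exact h0 i (Finset.mem_univ i)
  have hQz : (f 1).re = 0 → ∀ i, (f (Q i)).re = 0 := fun h0 i => by
    rw [← hsumQ, Finset.sum_eq_zero_iff_of_nonneg fun i _ => hQ' i] at h0
    exact h0 i (Finset.mem_univ i)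
  have hPψ : ∑ i, f.toPreGNS (P i) = f.toPreGNS 1 := by rw [← map_sum, hP1]
  have hQψ : ∑ i, f.toPreGNS (Q i) = f.toPreGNS 1 := by rw [← map_sum, hQ1]
  have main := sum_norm_sq_mul_log_le (k := √c)
    (fun i j hij => by
      change ⟪f.toPreGNS (P i), f.toPreGNS (P j)⟫_ℂ = 0
      rw [PositiveLinearMap.preGNS_inner_def]
      simp [(hP i).isSelfAdjoint.star_eq, hP0 hij])
    (fun i j hij => by
      change ⟪f.toPreGNS (Q i), f.toPreGNS (Q j)⟫_ℂ = 0
      rw [PositiveLinearMap.preGNS_inner_def]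
      simp [(hQ i).isSelfAdjoint.star_eq, hQ0 hij])
    hPψ hQψ (Real.sqrt_pos.2 hc)
    (fun i j => (norm_inner_toPreGNS_le f (hP i) (hQ j)).trans (by
      gcongr
      exact Real.le_sqrt_of_sq_le (h i j)))
  -- turn norms into weights: `‖P‖² log ‖P‖ = ½ f(P) log f(P)`
  have half : ∀ {R : A}, IsStarProjection R → ‖f.toPreGNS R‖ ^ 2 * Real.log ‖f.toPreGNS R‖ =
      (f R).re * Real.log (f R).re / 2 := by
    intro R hR
    rw [← norm_toPreGNS_sq_of_isStarProjection f hR, Real.log_pow]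
    push_cast; ring
  have hone : IsStarProjection (1 : A) := .one A
  simp only [half (hP _), half (hQ _), norm_toPreGNS_sq_of_isStarProjection f hone] at main
  simp only [mul_logb_div_eq fun h0 => hPz h0 _, mul_logb_div_eq fun h0 => hQz h0 _]
  rw [← Finset.sum_div, ← Finset.sum_div, ← add_div, Real.logb, ← mul_div_assoc,
    div_le_div_iff_of_pos_right hlog2, Finset.sum_sub_distrib, Finset.sum_sub_distrib,
    ← Finset.sum_mul, ← Finset.sum_mul, hsumP, hsumQ]
  rw [← Finset.sum_div, ← Finset.sum_div] at main
  have hlast : (f 1).re * Real.log (√c * (f 1).re) =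
      (f 1).re * Real.log c / 2 + (f 1).re * Real.log (f 1).re := by
    rcases eq_or_ne (f 1).re 0 with h0 | h0
    · simp [h0]
    · rw [Real.log_mul (Real.sqrt_pos.2 hc).ne' h0, Real.log_sqrt hc.le]; ring
  rw [hlast] at main
  linarith

end PositiveFunctional

/-! ### Spectral projectors and their overlap -/

section Spectral

variable {H : Type*} [NormedAddCommGroup H] [InnerProductSpace ℂ H] [FiniteDimensional ℂ H]

lemma isStarProjection_spectralProj (X : Op H) (x : Eig X) : IsStarProjection (spectralProj X x) :=
  isStarProjection_starProjection

variable {X : Op H}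

lemma sum_spectralProj (hX : IsSelfAdjoint X) : ∑ x, spectralProj X x = 1 := by
  have hs := ContinuousLinearMap.isSelfAdjoint_iff_isSymmetric.1 hX
  ext v
  rw [_root_.sum_apply]
  refine hs.orthogonalFamily_eigenspaces'.sum_projection_of_mem_iSup v ?_
  rw [Submodule.orthogonal_eq_bot_iff.mp hs.orthogonalComplement_iSup_eigenspaces_eq_bot']
  trivial

lemma spectralProj_mul_spectralProj (hX : IsSelfAdjoint X) :
    Pairwise fun x y => spectralProj X x * spectralProj X y = 0 :=
  fun _ _ hxy => ((ContinuousLinearMap.isSelfAdjoint_iff_isSymmetric.1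
    hX).orthogonalFamily_eigenspaces'.isOrtho hxy).starProjection_comp_starProjection

end Spectral

section Overlap

variable {H : Type*} [NormedAddCommGroup H] [InnerProductSpace ℂ H] [FiniteDimensional ℂ H]

lemma norm_sq_le_overlap (X Z : Op H) (x : Eig X) (z : Eig Z) :
    ‖spectralProj X x * spectralProj Z z‖ ^ 2 ≤ overlap X Z :=
  le_ciSup (f := fun p : Eig X × Eig Z => ‖spectralProj X p.1 * spectralProj Z p.2‖ ^ 2)
    (Set.finite_range _).bddAbove (x, z)

/-- The overlap cannot vanish, since the products `X_x Z_z` sum to the identity. -/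
lemma overlap_pos [Nontrivial H] {X Z : Op H} (hX : IsSelfAdjoint X) (hZ : IsSelfAdjoint Z) :
    0 < overlap X Z := by
  by_contra! hle
  have h0 : ∀ x z, spectralProj X x * spectralProj Z z = 0 := fun x z => by
    have := (norm_sq_le_overlap X Z x z).trans hle
    have := le_antisymm this (sq_nonneg _)
    simpa using this
  have h1 : (1 : Op H) = 0 := by
    rw [← mul_one (1 : Op H)]
    nth_rw 1 [← sum_spectralProj hX]
    rw [← sum_spectralProj hZ, Finset.sum_mul_sum]
    simp [h0]
  exact one_ne_zero h1

end Overlap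

/-! ### The trace and the classical register -/

section Trace

variable {H : Type*} [NormedAddCommGroup H] [InnerProductSpace ℂ H]

@[simp] lemma tr_add (A B : Op H) : tr (A + B) = tr A + tr B := by simp [tr]

@[simp] lemma tr_smul (c : ℂ) (A : Op H) : tr (c • A) = c * tr A := by simp [tr]

lemma tr_sum {ι : Type*} (s : Finset ι) (A : ι → Op H) : tr (∑ i ∈ s, A i) = ∑ i ∈ s, tr (A i) := by
  simp [tr]

lemma tr_mul_comm (A B : Op H) : tr (A * B) = tr (B * A) :=
  LinearMap.trace_mul_comm ℂ (A : H →ₗ[ℂ] H) B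

lemma tr_one [FiniteDimensional ℂ H] : tr (1 : Op H) = Module.finrank ℂ H := by
  rw [tr]; exact LinearMap.trace_one ℂ H

lemma tr_nonneg {A : Op H} (hA : 0 ≤ A) : 0 ≤ tr A :=
  ((ContinuousLinearMap.nonneg_iff_isPositive A).1 hA).toLinearMap.trace_nonneg

lemma tr_mul_nonneg [FiniteDimensional ℂ H] {P A : Op H} (hP : IsStarProjection P)
    (hA : 0 ≤ A) : 0 ≤ tr (P * A) := by
  have h : tr (P * A) = tr (P * A * star P) := by
    rw [hP.isSelfAdjoint.star_eq, tr_mul_comm (P * A) P, ← mul_assoc, hP.isIdempotentElem.eq]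
  rw [h]
  exact tr_nonneg (star_right_conjugate_nonneg hA P)

end Trace

section Register

variable {K M : Type*} [NormedAddCommGroup K] [InnerProductSpace ℂ K] [FiniteDimensional ℂ K]
  [Fintype M] [DecidableEq M]

lemma isStarProjection_flag (m : M) : IsStarProjection (flag m) :=
  InnerProductSpace.isStarProjection_rankOne_self (by simp)

lemma tr_flag (m : M) : tr (flag m) = 1 := by
  rw [tr, flag, InnerProductSpace.trace_rankOne]; simp

lemma tr_mapL_flag (A : Op K) (m : M) : tr (TensorProduct.mapL A (flag m)) = tr A := by
  rw [tr, TensorProduct.toLinearMap_mapL, LinearMap.trace_tensorProduct']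
  change tr A * tr (flag m) = tr A
  rw [tr_flag, mul_one]

lemma mapL_flag_nonneg {A : Op K} (hA : 0 ≤ A) (m : M) : 0 ≤ TensorProduct.mapL A (flag m) := by
  obtain ⟨B, rfl⟩ := CStarAlgebra.nonneg_iff_eq_star_mul_self.1 hA
  have hf := isStarProjection_flag m
  have h : TensorProduct.mapL (star B * B) (flag m) =
      star (TensorProduct.mapL B (flag m)) * TensorProduct.mapL B (flag m) := by
    have hs : star (TensorProduct.mapL B (flag m)) = TensorProduct.mapL (star B) (flag m) := by
      rw [ContinuousLinearMap.star_eq_adjoint, TensorProduct.adjoint_mapL,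
        ← ContinuousLinearMap.star_eq_adjoint, ← ContinuousLinearMap.star_eq_adjoint,
        hf.isSelfAdjoint.star_eq]
    rw [hs, ← TensorProduct.mapL_mul, hf.isIdempotentElem.eq]
  rw [h]
  exact star_mul_self_nonneg _

end Register

/-! ### The joint measurement of the apparatus and the corrected observable -/

section Joint

variable {H K M : Type*}
  [NormedAddCommGroup H] [InnerProductSpace ℂ H] [FiniteDimensional ℂ H]
  [NormedAddCommGroup K] [InnerProductSpace ℂ K] [FiniteDimensional ℂ K]
  [Fintype M] [DecidableEq M]

lemma inv_natCast_nonneg (n : ℕ) : (0 : ℂ) ≤ (n : ℂ)⁻¹ := by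
  rw [← Complex.ofReal_natCast, ← Complex.ofReal_inv]
  exact Complex.zero_le_real.2 (by positivity)

/-- The positive functional `ρ ↦ (1 / d) Tr[Z_ẑ 𝓔(𝓜ᵐ(ρ) ⊗ |m⟩⟨m|)]`. For fixed `𝓔` these functionals
represent the joint measurement of the outcome `m` and of the result `ẑ` of the corrected
measurement, together with the maximally mixed prior. -/
noncomputable def jointFunctional (𝓜 : Instrument H K M) (Z : Op H)
    (𝓔 : Channel (K ⊗[ℂ] EuclideanSpace ℂ M) H) (z' : Eig Z) (m : M) : Op H →ₚ[ℂ] ℂ :=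
  PositiveLinearMap.mk₀
    { toFun := fun ρ => (Module.finrank ℂ H : ℂ)⁻¹ *
        tr (spectralProj Z z' * 𝓔.map (TensorProduct.mapL (𝓜.map m ρ) (flag m)))
      map_add' := fun ρ σ => by
        simp only [map_add, TensorProduct.mapL_add_left, mul_add, tr_add]
      map_smul' := fun c ρ => by
        simp only [map_smul, TensorProduct.mapL_smul_left, mul_smul_comm, tr_smul, RingHom.id_apply,
          smul_eq_mul]
        ring }
    fun ρ hρ => mul_nonneg (inv_natCast_nonneg _)
      (tr_mul_nonneg (isStarProjection_spectralProj Z z')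
        (map_nonneg 𝓔.map (mapL_flag_nonneg (map_nonneg (𝓜.map m) hρ) m)))

lemma jointFunctional_apply (𝓜 : Instrument H K M) (Z : Op H)
    (𝓔 : Channel (K ⊗[ℂ] EuclideanSpace ℂ M) H) (z' : Eig Z) (m : M) (ρ : Op H) :
    jointFunctional 𝓜 Z 𝓔 z' m ρ = (Module.finrank ℂ H : ℂ)⁻¹ *
        tr (spectralProj Z z' * 𝓔.map (TensorProduct.mapL (𝓜.map m ρ) (flag m))) := rfl

lemma prior_smul_eigenState (X : Op H) (x : Eig X) :
    (prior X x : ℂ) • eigenState X x = (Module.finrank ℂ H : ℂ)⁻¹ • spectralProj X x := by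
  have h : (degeneracy X x : ℂ) ≠ 0 := by
    rw [Nat.cast_ne_zero, degeneracy]
    have hx : eigenspace X x ≠ ⊥ := x.2
    exact mt Submodule.finrank_eq_zero.1 hx
  rw [prior, eigenState, smul_smul]
  push_cast
  congr 1
  field_simp

variable (𝓜 : Instrument H K M) (X Z : Op H) (𝓔 : Channel (K ⊗[ℂ] EuclideanSpace ℂ M) H)

/-- Summing over `ẑ` erases the correction, as it preserves the trace. -/
lemma sum_jointFunctional (hZ : IsSelfAdjoint Z) (m : M) (ρ : Op H) :
    ∑ z', jointFunctional 𝓜 Z 𝓔 z' m ρ = (Module.finrank ℂ H : ℂ)⁻¹ * tr (𝓜.map m ρ) := by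
  simp only [jointFunctional_apply]
  rw [← Finset.mul_sum, ← tr_sum, ← Finset.sum_mul, sum_spectralProj hZ, one_mul,
    𝓔.trace_preserving, tr_mapL_flag]

lemma noiseDist_eq (hZ : IsSelfAdjoint Z) (x : Eig X) (m : M) :
    noiseDist 𝓜 X x m = ∑ z', (jointFunctional 𝓜 Z 𝓔 z' m (spectralProj X x)).re := by
  rw [← Complex.re_sum, sum_jointFunctional 𝓜 Z 𝓔 hZ, noiseDist, ← Complex.re_ofReal_mul, ← tr_smul,
    ← map_smul, prior_smul_eigenState, map_smul, tr_smul]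

lemma disturbanceDist_eq (z z' : Eig Z) :
    disturbanceDist 𝓜 Z 𝓔 z z' = ∑ m, (jointFunctional 𝓜 Z 𝓔 z' m (spectralProj Z z)).re := by
  have hsmul : ∀ (c : ℂ) (ρ : Op H), 𝓜.apply (c • ρ) = c • 𝓜.apply ρ := fun c ρ => by
    simp only [Instrument.apply, map_smul, TensorProduct.mapL_smul_left]
    exact (Finset.smul_sum (r := c) (s := Finset.univ)
      (f := fun m => TensorProduct.mapL (𝓜.map m ρ) (flag m))).symm
  rw [← Complex.re_sum, disturbanceDist, ← Complex.re_ofReal_mul, ← tr_smul, ← mul_smul_comm,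
    ← map_smul, ← hsmul, prior_smul_eigenState, hsmul, map_smul, mul_smul_comm, tr_smul,
    Instrument.apply, map_sum, Finset.mul_sum, tr_sum, Finset.mul_sum]
  rfl

lemma sum_sum_jointFunctional_one [Nontrivial H] (hZ : IsSelfAdjoint Z) :
    ∑ z', ∑ m, (jointFunctional 𝓜 Z 𝓔 z' m 1).re = 1 := by
  rw [Finset.sum_comm]
  simp only [← Complex.re_sum, sum_jointFunctional 𝓜 Z 𝓔 hZ]
  rw [← Finset.mul_sum, ← tr_sum, 𝓜.trace_preserving, tr_one, inv_mul_cancel₀, Complex.one_re]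
  exact Nat.cast_ne_zero.2 Module.finrank_pos.ne'

/-- The noise–disturbance relation for an arbitrary correction: both entropies decrease when
conditioned on the pair `(m, ẑ)`, and then the uncertainty relation applies to each
`jointFunctional`. -/
theorem noise_add_correctedEntropy_ge [Nontrivial H] (hX : IsSelfAdjoint X) (hZ : IsSelfAdjoint Z) :
    -Real.logb 2 (overlap X Z) ≤ noise 𝓜 X + correctedEntropy 𝓜 Z 𝓔 := by
  set L := jointFunctional 𝓜 Z 𝓔
  have hnn : ∀ (Y : Op H) (y : Eig Y) z' m, 0 ≤ (L z' m (spectralProj Y y)).re := fun Y y z' m =>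
    (Complex.le_def.1 (map_nonneg (L z' m) (isStarProjection_spectralProj Y y).nonneg)).1
  have hsum : ∀ {Y : Op H}, IsSelfAdjoint Y → ∀ z' m,
      ∑ y, (L z' m (spectralProj Y y)).re = (L z' m 1).re := fun hY z' m => by
    rw [← Complex.re_sum, ← map_sum, sum_spectralProj hY]
  have hN := condEntropy_le_condEntropy_sum
    (p := fun x m z' => (L z' m (spectralProj X x)).re) fun x m z' => hnn X x z' m
  have hD := condEntropy_le_condEntropy_sum
    (p := fun z z' m => (L z' m (spectralProj Z z)).re) fun z z' m => hnn Z z z' m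
  simp only [L, ← noiseDist_eq 𝓜 X Z 𝓔 hZ, ← disturbanceDist_eq 𝓜 Z 𝓔] at hN hD
  refine le_trans ?_ (add_le_add hN hD)
  simp only [condEntropy, Fintype.sum_prod_type]
  change _ ≤ -(∑ m, ∑ z', ∑ x, (L z' m (spectralProj X x)).re *
    Real.logb 2 ((L z' m (spectralProj X x)).re / ∑ x', (L z' m (spectralProj X x')).re)) +
    -(∑ z', ∑ m, ∑ z, (L z' m (spectralProj Z z)).re *
    Real.logb 2 ((L z' m (spectralProj Z z)).re / ∑ x', (L z' m (spectralProj Z x')).re))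
  simp only [hsum hX, hsum hZ]
  rw [Finset.sum_comm, ← neg_add, neg_le_neg_iff, ← Finset.sum_add_distrib]
  calc _ ≤ ∑ z', ∑ m, (L z' m 1).re * Real.logb 2 (overlap X Z) := by
        refine Finset.sum_le_sum fun z' _ => ?_
        rw [← Finset.sum_add_distrib]
        exact Finset.sum_le_sum fun m _ => entropic_uncertainty (L z' m)
          (isStarProjection_spectralProj X) (isStarProjection_spectralProj Z)
          (spectralProj_mul_spectralProj hX) (spectralProj_mul_spectralProj hZ)
          (sum_spectralProj hX) (sum_spectralProj hZ) (overlap_pos hX hZ)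
          (norm_sq_le_overlap X Z)
    _ = Real.logb 2 (overlap X Z) := by
        simp only [← Finset.sum_mul]
        rw [sum_sum_jointFunctional_one 𝓜 Z 𝓔 hZ, one_mul]

end Joint

/-! ### Compactness of the set of channels -/

/-- Stated for an abstract C⋆-algebra, so that it applies to `CStarMatrix`, whose ring structure
hides the instances needed for a direct use of the continuous functional calculus. -/
lemma exists_eq_star_mul_self_of_nonneg {A : Type*} [NonUnitalCStarAlgebra A] [PartialOrder A]
    [StarOrderedRing A] {a : A} (ha : 0 ≤ a) : ∃ b, a = star b * b :=
  CStarAlgebra.nonneg_iff_eq_star_mul_self.1 ha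

section ChannelSet

variable {J H : Type*}
  [NormedAddCommGroup J] [InnerProductSpace ℂ J] [FiniteDimensional ℂ J]
  [NormedAddCommGroup H] [InnerProductSpace ℂ H] [FiniteDimensional ℂ H]

variable (J H) in
/-- The channels from `J` to `H`, as a subset of the finite-dimensional normed space of continuous
linear maps between the operator algebras. -/
def channelSet : Set (Op J →L[ℂ] Op H) :=
  {Φ | (∀ (k : ℕ) (N : CStarMatrix (Fin k) (Fin k) (Op J)), 0 ≤ N → 0 ≤ N.map Φ) ∧
    ∀ ρ, tr (Φ ρ) = tr ρ}

/-- The channel given by an element of `channelSet`. -/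
def toChannel (Φ : Op J →L[ℂ] Op H) (hΦ : Φ ∈ channelSet J H) : Channel J H where
  map := { (Φ : Op J →ₗ[ℂ] Op H) with map_cstarMatrix_nonneg' := hΦ.1 }
  trace_preserving := hΦ.2

/-- The continuous linear map underlying a channel. -/
noncomputable def Channel.toCLM (𝓔 : Channel J H) : Op J →L[ℂ] Op H :=
  LinearMap.toContinuousLinearMap 𝓔.map.toLinearMap

lemma Channel.toCLM_mem (𝓔 : Channel J H) : 𝓔.toCLM ∈ channelSet J H :=
  ⟨𝓔.map.map_cstarMatrix_nonneg', 𝓔.trace_preserving⟩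

lemma continuous_tr : Continuous (tr : Op H → ℂ) :=
  LinearMap.continuous_of_finiteDimensional
    ((LinearMap.trace ℂ H).comp (ContinuousLinearMap.coeLM ℂ : Op H →ₗ[ℂ] (H →ₗ[ℂ] H)))

lemma isClosed_channelSet : IsClosed (channelSet J H) := by
  have h : channelSet J H =
      (⋂ (k : ℕ) (N : CStarMatrix (Fin k) (Fin k) (Op J)) (_ : 0 ≤ N),
        {Φ : Op J →L[ℂ] Op H | 0 ≤ N.map Φ}) ∩
        ⋂ ρ : Op J, {Φ : Op J →L[ℂ] Op H | tr (Φ ρ) = tr ρ} := by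
    ext Φ; simp [channelSet]
  rw [h]
  refine IsClosed.inter ?_ ?_
  · refine isClosed_iInter fun k => isClosed_iInter fun N => isClosed_iInter fun _ => ?_
    let ev : (Op J →L[ℂ] Op H) →ₗ[ℂ] CStarMatrix (Fin k) (Fin k) (Op H) :=
      { toFun := fun Φ => N.map Φ
        map_add' := fun _ _ => rfl
        map_smul' := fun _ _ => rfl }
    exact isClosed_Ici.preimage (LinearMap.continuous_of_finiteDimensional ev)
  · refine isClosed_iInter fun ρ => isClosed_eq ?_ continuous_const
    exact continuous_tr.comp (ContinuousLinearMap.apply ℂ (Op H) ρ).continuous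

/-- The operator norm of a positive operator `B⋆ B` is at most its trace, which is the squared
Hilbert–Schmidt norm of `B`. -/
lemma norm_le_re_tr {A : Op H} (hA : 0 ≤ A) : ‖A‖ ≤ (tr A).re := by
  obtain ⟨B, rfl⟩ := CStarAlgebra.nonneg_iff_eq_star_mul_self.1 hA
  set b := stdOrthonormalBasis ℂ H
  have htr : (tr (star B * B)).re = ∑ i, ‖B (b i)‖ ^ 2 := by
    rw [tr, LinearMap.trace_eq_sum_inner _ b, Complex.re_sum]
    refine Finset.sum_congr rfl fun i _ => ?_
    have : ⟪b i, (star B * B) (b i)⟫_ℂ = ⟪B (b i), B (b i)⟫_ℂ := by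
      rw [ContinuousLinearMap.star_eq_adjoint]
      exact ContinuousLinearMap.adjoint_inner_right B _ _
    change (⟪b i, (star B * B) (b i)⟫_ℂ).re = _
    rw [this, inner_self_eq_norm_sq_to_K]
    norm_cast
  rw [htr, CStarRing.norm_star_mul_self, ← sq, ← Real.le_sqrt (norm_nonneg _)
    (Finset.sum_nonneg fun _ _ => sq_nonneg _)]
  refine ContinuousLinearMap.opNorm_le_bound _ (Real.sqrt_nonneg _) fun v => ?_
  have hv : B v = ∑ i, ⟪b i, v⟫_ℂ • B (b i) := by
    conv_lhs => rw [← b.sum_repr' v, map_sum]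
    simp
  rw [hv]
  calc ‖∑ i, ⟪b i, v⟫_ℂ • B (b i)‖ ≤ ∑ i, ‖B (b i)‖ * ‖⟪b i, v⟫_ℂ‖ :=
        (norm_sum_le _ _).trans_eq (Finset.sum_congr rfl fun i _ => by rw [norm_smul, mul_comm])
    _ ≤ √(∑ i, ‖B (b i)‖ ^ 2) * √(∑ i, ‖⟪b i, v⟫_ℂ‖ ^ 2) :=
        Real.sum_mul_le_sqrt_mul_sqrt _ _ _
    _ = _ := by rw [b.sum_sq_norm_inner_right, Real.sqrt_sq (norm_nonneg _)]

/-- Trace-preserving positive maps are uniformly bounded: on positive operators the norm is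
dominated by the trace, and every operator is a combination of four positive ones. -/
lemma isBounded_channelSet : Bornology.IsBounded (channelSet J H) := by
  obtain ⟨C, hC0, hC⟩ : ∃ C : ℝ, 0 ≤ C ∧ ∀ ρ : Op J, ‖tr ρ‖ ≤ C * ‖ρ‖ := by
    let T : Op J →L[ℂ] ℂ := LinearMap.toContinuousLinearMap
      ((LinearMap.trace ℂ J).comp (ContinuousLinearMap.coeLM ℂ : Op J →ₗ[ℂ] (J →ₗ[ℂ] J)))
    exact ⟨‖T‖, norm_nonneg _, T.le_opNorm⟩
  rw [isBounded_iff_forall_norm_le]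
  refine ⟨4 * C, fun Φ hΦ => ContinuousLinearMap.opNorm_le_bound _ (by positivity) fun a => ?_⟩
  have hpos : ∀ ρ : Op J, 0 ≤ ρ → ‖Φ ρ‖ ≤ C * ‖ρ‖ := fun ρ hρ => by
    have h0 : 0 ≤ Φ ρ := map_nonneg (toChannel Φ hΦ).map hρ
    calc ‖Φ ρ‖ ≤ (tr (Φ ρ)).re := norm_le_re_tr h0
      _ = (tr ρ).re := by rw [hΦ.2]
      _ ≤ ‖tr ρ‖ := Complex.re_le_norm _
      _ ≤ C * ‖ρ‖ := hC ρ
  obtain ⟨x, hx0, hxn, hx⟩ := CStarAlgebra.exists_sum_four_nonneg a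
  calc ‖Φ a‖ = ‖∑ i : Fin 4, Complex.I ^ (i : ℕ) • Φ (x i)‖ := by
        conv_lhs => rw [hx, map_sum]
        simp only [map_smul]
    _ ≤ ∑ i : Fin 4, C * ‖a‖ := by
        refine (norm_sum_le _ _).trans (Finset.sum_le_sum fun i _ => ?_)
        rw [norm_smul, norm_pow, Complex.norm_I, one_pow, one_mul]
        exact (hpos _ (hx0 i)).trans (mul_le_mul_of_nonneg_left (hxn i) hC0)
    _ = 4 * C * ‖a‖ := by simp; ring

lemma isCompact_channelSet : IsCompact (channelSet J H) :=
  have : ProperSpace (Op J →L[ℂ] Op H) := FiniteDimensional.proper ℂ _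
  Metric.isCompact_of_isClosed_isBounded isClosed_channelSet isBounded_channelSet

/-- Complete positivity of `T ↦ Tr(T) 1`: the matrix entries `⟪e_s, T e_l⟫` of the factor `B` in
`N = B⋆ B` give a decomposition of the image of `N` into a sum of squares. -/
lemma map_tr_smul_one_nonneg {k : ℕ} {N : CStarMatrix (Fin k) (Fin k) (Op J)} (hN : 0 ≤ N) :
    0 ≤ N.map fun T : Op J => tr T • (1 : Op H) := by
  obtain ⟨B, rfl⟩ := exists_eq_star_mul_self_of_nonneg hN
  set b := stdOrthonormalBasis ℂ J
  let D := fun l s => B.map fun T : Op J => ⟪b s, T (b l)⟫_ℂ • (1 : Op H)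
  have h : (star B * B).map (fun T : Op J => tr T • (1 : Op H)) =
      ∑ l, ∑ s, star (D l s) * D l s := by
    ext1 i j
    have hent : ∀ T S : Op J, tr (star T * S) =
        ∑ l, ∑ s, (starRingEnd ℂ) ⟪b s, T (b l)⟫_ℂ * ⟪b s, S (b l)⟫_ℂ := fun T S => by
      rw [tr, LinearMap.trace_eq_sum_inner _ b]
      refine Finset.sum_congr rfl fun l _ => ?_
      have : ⟪b l, (star T * S) (b l)⟫_ℂ = ⟪T (b l), S (b l)⟫_ℂ := by
        rw [ContinuousLinearMap.star_eq_adjoint]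
        exact ContinuousLinearMap.adjoint_inner_right T _ _
      change ⟪b l, (star T * S) (b l)⟫_ℂ = _
      rw [this, ← b.sum_inner_mul_inner]
      exact Finset.sum_congr rfl fun s _ => by rw [inner_conj_symm]
    let entry : CStarMatrix (Fin k) (Fin k) (Op H) →+ Op H :=
      { toFun := fun M => M i j, map_zero' := rfl, map_add' := fun _ _ => rfl }
    have hsum : (∑ l, ∑ s, star (D l s) * D l s) i j = ∑ l, ∑ s, (star (D l s) * D l s) i j :=
      (map_sum entry (fun l => ∑ s, star (D l s) * D l s) Finset.univ).trans
        (Finset.sum_congr rfl fun l _ =>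
          map_sum entry (fun s => star (D l s) * D l s) Finset.univ)
    rw [hsum, CStarMatrix.map_apply, CStarMatrix.mul_apply, tr_sum, Finset.sum_smul]
    simp only [CStarMatrix.mul_apply, CStarMatrix.star_apply, hent, D, CStarMatrix.map_apply,
      star_smul, star_one, smul_mul_smul_comm, mul_one, Finset.sum_smul]
    rw [Finset.sum_comm]
    exact Finset.sum_congr rfl fun _ _ => Finset.sum_comm
  rw [h]
  exact Finset.sum_nonneg fun _ _ => Finset.sum_nonneg fun _ _ => star_mul_self_nonneg _

/-- A channel exists: discard the input and prepare the maximally mixed state. -/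
lemma channelSet_nonempty [Nontrivial H] : (channelSet J H).Nonempty := by
  let Φ : Op J →ₗ[ℂ] Op H :=
    { toFun := fun T => (Module.finrank ℂ H : ℂ)⁻¹ • tr T • (1 : Op H)
      map_add' := fun _ _ => by rw [tr_add, add_smul, smul_add]
      map_smul' := fun c T => by
        rw [tr_smul, RingHom.id_apply, mul_smul, smul_comm c ((_ : ℂ)⁻¹)] }
  refine ⟨LinearMap.toContinuousLinearMap Φ, fun k N hN => ?_, fun ρ => ?_⟩
  · have h := smul_nonneg (α := ℂ) (inv_natCast_nonneg (Module.finrank ℂ H))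
      (map_tr_smul_one_nonneg (H := H) hN)
    exact h
  · change tr ((Module.finrank ℂ H : ℂ)⁻¹ • tr ρ • (1 : Op H)) = _
    rw [tr_smul, tr_smul, tr_one]
    have : (Module.finrank ℂ H : ℂ) ≠ 0 := Nat.cast_ne_zero.2 Module.finrank_pos.ne'
    field_simp

end ChannelSet

/-! ### Existence of an optimal correction -/

section Attained

variable {H K M : Type*}
  [NormedAddCommGroup H] [InnerProductSpace ℂ H] [FiniteDimensional ℂ H]
  [NormedAddCommGroup K] [InnerProductSpace ℂ K] [FiniteDimensional ℂ K]
  [Fintype M] [DecidableEq M]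

/-- `H(Z|Ẑ)` is the restriction to `channelSet` of a continuous function, so it has a minimum. -/
theorem exists_isLeast_correctedEntropy [Nontrivial H] (𝓜 : Instrument H K M) (Z : Op H) :
    ∃ a, IsLeast (Set.range (correctedEntropy 𝓜 Z)) a := by
  set p : (Op (K ⊗[ℂ] EuclideanSpace ℂ M) →L[ℂ] Op H) → Eig Z → Eig Z → ℝ := fun Φ z z' =>
    prior Z z * (tr (spectralProj Z z' * Φ (𝓜.apply (eigenState Z z)))).re with hp
  have hpc : ∀ z z', Continuous fun Φ => p Φ z z' := fun z z' => by
    refine continuous_const.mul (Complex.continuous_re.comp (continuous_tr.comp ?_))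
    exact continuous_const.mul (ContinuousLinearMap.apply ℂ (Op H) _).continuous
  set G : (Op (K ⊗[ℂ] EuclideanSpace ℂ M) →L[ℂ] Op H) → ℝ := fun Φ =>
    (∑ z', ∑ z, Real.negMulLog (p Φ z z') - ∑ z', Real.negMulLog (∑ z, p Φ z z')) / Real.log 2
    with hG
  have hGc : Continuous G := by
    refine Continuous.div_const (Continuous.sub ?_ ?_) _
    · exact continuous_finsetSum _ fun z' _ => continuous_finsetSum _ fun z _ =>
        Real.continuous_negMulLog.comp (hpc z z')
    · exact continuous_finsetSum _ fun z' _ => Real.continuous_negMulLog.comp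
        (continuous_finsetSum _ fun z _ => hpc z z')
  have hGE : ∀ 𝓔 : Channel (K ⊗[ℂ] EuclideanSpace ℂ M) H, correctedEntropy 𝓜 Z 𝓔 = G 𝓔.toCLM :=
    fun 𝓔 => condEntropy_eq_sum_negMulLog fun z z' => by
      rw [disturbanceDist_eq]
      exact Finset.sum_nonneg fun m _ => (Complex.le_def.1
        (map_nonneg (jointFunctional 𝓜 Z 𝓔 z' m) (isStarProjection_spectralProj Z z).nonneg)).1
  obtain ⟨Φ, hΦ, hmin⟩ := isCompact_channelSet.exists_isMinOn channelSet_nonempty hGc.continuousOn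
  refine ⟨G Φ, ⟨toChannel Φ hΦ, hGE _⟩, ?_⟩
  rintro _ ⟨𝓔, rfl⟩
  rw [hGE]
  exact hmin 𝓔.toCLM_mem

end Attained

end NoiseDisturbance

theorem mainTheorem4 {H K M : Type*}
    [NormedAddCommGroup H] [InnerProductSpace ℂ H] [FiniteDimensional ℂ H] [Nontrivial H]
    [NormedAddCommGroup K] [InnerProductSpace ℂ K] [FiniteDimensional ℂ K]
    [Fintype M] [DecidableEq M]
    (𝓜 : NoiseDisturbance.Instrument H K M)
    (X Z : H →L[ℂ] H) (hX : IsSelfAdjoint X) (hZ : IsSelfAdjoint Z) :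
    IsLeast (Set.range (NoiseDisturbance.correctedEntropy 𝓜 Z))
        (NoiseDisturbance.disturbance 𝓜 Z) ∧
      NoiseDisturbance.noise 𝓜 X + NoiseDisturbance.disturbance 𝓜 Z ≥
        -Real.logb 2 (NoiseDisturbance.overlap X Z) := by
  obtain ⟨a, ha⟩ := NoiseDisturbance.exists_isLeast_correctedEntropy 𝓜 Z
  have hD : NoiseDisturbance.disturbance 𝓜 Z = a := ha.csInf_eq
  rw [hD]
  refine ⟨ha, ?_⟩
  obtain ⟨𝓔, rfl⟩ := ha.1
  exact NoiseDisturbance.noise_add_correctedEntropy_ge 𝓜 X Z 𝓔 hX hZ
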